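/- Let $K$ be a compact metrizable space with its Borel $\sigma$-algebra, let $\Omega=K^{\mathbb Z}$ carry the product topology and product $\sigma$-algebra, and let $\mathcal S$ be the set of all exchangeable probability measures on $\Omega$, i.e. those probability measures $\mu$ that are invariant under $\omega\mapsto(\omega_{\sigma(n)})_{n\in\mathbb Z}$ for every permutation $\sigma$ of $\mathbb Z$ moving only finitely many integers. Regard $\mathcal S$ as a subset of the dual $C(\Omega,\mathbb R)^*$, with the weak-star topology, through $\mu\mapsto(f\mapsto\int f\,d\mu)$. (i) $\mathcal S$ is a Choquet simplex: it is convex and compact and, if $P\subset C(\Omega,\mathbb R)^*\times\mathbb R$ denotes the convex cone (with vertex $0$) generated by $\mathcal S\times\{1\}$, the space $P-P$ is a vector lattice for the order $u\le v\iff v-u\in P$. (ii) Every $\mu\in\mathcal S$ is the barycenter of a unique probability measure supported on the Bernoulli measures: there is exactly one probability measure $\eta$ on the space of probability measures on $\Omega$ such that $\eta$ is carried by the set $\mathrm{Ber}$ of Bernoulli measures (the product measures $\pi^{\otimes\mathbb Z}$, $\pi$ a probability measure on $K$) and $\mu(A)=\int \xi(A)\,d\eta(\xi)$ for every Borel set $A\subset\Omega$.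 -/

import Mathlib

open MeasureTheory

/-- The cone in `E × ℝ` generated by the copy `X × {1}` of `X` at height one
(all finite non-negative combinations of its points). For convex `X` it is
`{(t • x, t) | t ≥ 0, x ∈ X}`, together with `0`, and `X × {1}` is a base of it. -/
def coneOver {E : Type*} [AddCommGroup E] [Module ℝ E] (X : Set E) : PointedCone ℝ (E × ℝ) :=
  PointedCone.hull ℝ (X ×ˢ {(1 : ℝ)})

/-- A (Choquet) simplex: a compact convex set `X` such that, with `P` the cone generated by
`X × {1}`, the space `P - P` is a vector lattice for the order `u ≤ v ↔ v - u ∈ P`.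
Here `P - P` is the linear span of `X × {1}`. It is enough to ask for the suprema of pairs. -/
structure IsChoquetSimplex {E : Type*} [AddCommGroup E] [Module ℝ E] [TopologicalSpace E]
    (X : Set E) : Prop where
  convex : Convex ℝ X
  isCompact : IsCompact X
  exists_sup : ∀ u ∈ Submodule.span ℝ (X ×ˢ {(1 : ℝ)}), ∀ v ∈ Submodule.span ℝ (X ×ˢ {(1 : ℝ)}),
    ∃ w ∈ Submodule.span ℝ (X ×ˢ {(1 : ℝ)}), w - u ∈ coneOver X ∧ w - v ∈ coneOver X ∧
      ∀ z ∈ Submodule.span ℝ (X ×ˢ {(1 : ℝ)}),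
        z - u ∈ coneOver X → z - v ∈ coneOver X → z - w ∈ coneOver X

/-- The set of exchangeable probability measures on `K ^ ℤ`: those invariant under
`ω ↦ (n ↦ ω (σ n))` for every permutation `σ` of `ℤ` moving only finitely many integers. -/
def exchangeableMeasures (K : Type*) [MeasurableSpace K] : Set (ProbabilityMeasure (ℤ → K)) :=
  {μ | ∀ σ : Equiv.Perm ℤ, {n : ℤ | σ n ≠ n}.Finite →
    (μ : Measure (ℤ → K)).map (fun ω n => ω (σ n)) = μ}

/-- The set of Bernoulli measures on `K ^ ℤ`: the product measures `π ^ ⊗ℤ`, for `π` a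
probability measure on `K`. -/
def bernoulliMeasures (K : Type*) [MeasurableSpace K] : Set (ProbabilityMeasure (ℤ → K)) :=
  {ξ | ∃ π : ProbabilityMeasure K,
    (ξ : Measure (ℤ → K)) = Measure.infinitePi (fun _ : ℤ => (π : Measure K))}

/-- A set of probability measures on a topological space `Ω`, seen (through `f ↦ ∫ f dμ`) as
a subset of the dual of `C(Ω, ℝ)` with the weak-star topology. -/
def asFunctionals {Ω : Type*} [TopologicalSpace Ω] [MeasurableSpace Ω]
    (S : Set (ProbabilityMeasure Ω)) : Set (WeakDual ℝ C(Ω, ℝ)) :=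
  {φ | ∃ μ ∈ S, ∀ f : C(Ω, ℝ), φ f = ∫ ω, f ω ∂(μ : Measure Ω)}

/-- `μ` is the barycenter of the probability measure `η` on the space of probability
measures: `μ(A) = ∫ ξ(A) dη(ξ)` for every measurable set `A`. -/
def IsBarycenter {Ω : Type*} [MeasurableSpace Ω] (η : Measure (ProbabilityMeasure Ω))
    (μ : ProbabilityMeasure Ω) : Prop :=
  ∀ A : Set Ω, MeasurableSet A →
    (μ : Measure Ω) A = ∫⁻ ξ : ProbabilityMeasure Ω, (ξ : Measure Ω) A ∂η

/-! Everything rests on one bijection: a probability measure `ν` on the space of probability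
measures on `K` corresponds to the exchangeable measure `∫ π^⊗ℤ dν(π)`.

Surjectivity is de Finetti's theorem, `exists_bernoulliKernel_comp_eq`: `ν` is a limit point of the
laws of the empirical measures under `μ`. When a product of empirical averages is expanded,
exchangeability makes every term with distinct indices equal to the same moment of `μ`, and the
proportion of the other terms tends to `0`.

Injectivity is `eq_of_bernoulliKernel_comp_eq`: moments of the mixture at distinct coordinates are
integrals against `ν` of monomials `∏ ∫ f i dπ`, and these determine `ν` by Stone–Weierstrass.

Extended to finite measures, the bijection identifies `P` with the cone of finite positive measures,
where suprema exist; this gives (i). For (ii), a measure carried by `Ber` is the image under `π ↦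
π^⊗ℤ` of its own image under the zeroth marginal, so being a barycenter becomes the mixture equation
for `ν`. -/

open ProbabilityTheory TopologicalSpace Filter Topology

/-! ### Borel structure on the space of probability measures -/

/-- The Giry σ-algebra on the probability measures on a compact metrizable space is the Borel
σ-algebra of the topology of convergence in distribution. -/
instance borelSpace_probabilityMeasure (X : Type*) [TopologicalSpace X] [CompactSpace X]
    [MetrizableSpace X] [MeasurableSpace X] [BorelSpace X] : BorelSpace (ProbabilityMeasure X) where
  measurable_eq := by
    apply le_antisymm
    · have key : @Measurable _ _ (borel (ProbabilityMeasure X)) _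
          (fun μ : ProbabilityMeasure X ↦ (μ : Measure X)) := by
        refine @Measurable.measure_of_isPiSystem_of_isProbabilityMeasure _ _
          (borel (ProbabilityMeasure X)) _ _ _ {s | IsClosed s} ?_ isPiSystem_isClosed ?_
        · rw [← borel_eq_generateFrom_isClosed, BorelSpace.measurable_eq (α := X)]
        · intro s hs
          -- The mass of a closed set is a pointwise limit of integrals of continuous functions.
          refine @measurable_of_tendsto_metrizable _ _ (borel _) _ _ _ _
            (fun n (μ : ProbabilityMeasure X) ↦ ∫⁻ x, hs.apprSeq n x ∂(μ : Measure X)) _ ?_ ?_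
          · intro n
            exact (ProbabilityMeasure.continuous_lintegral_boundedContinuousFunction
              (hs.apprSeq n)).borel_measurable
          · rw [tendsto_pi_nhds]
            exact fun μ ↦ HasOuterApproxClosed.tendsto_lintegral_apprSeq hs _
      exact Measurable.comap_le key
    · let S : Set (Set (ProbabilityMeasure X)) :=
        {s | ∃ (f : BoundedContinuousFunction X ℝ) (u : Set ℝ), IsOpen u ∧
          (fun μ : ProbabilityMeasure X ↦ ∫ x, f x ∂(μ : Measure X)) ⁻¹' u = s}
      have hS : (inferInstance : TopologicalSpace (ProbabilityMeasure X)) = .generateFrom S := by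
        apply le_antisymm
        · rw [le_generateFrom_iff_subset_isOpen]
          rintro s ⟨f, u, hu, rfl⟩
          exact hu.preimage
            (ProbabilityMeasure.continuous_integral_boundedContinuousFunction f)
        · rw [← continuous_id_iff_le]
          refine (@ProbabilityMeasure.continuous_iff_forall_continuous_integral X _ _ _ _
            (.generateFrom S) id).2 fun f ↦ ?_
          exact @Continuous.mk _ _ (.generateFrom S) _ _ fun u hu ↦
            isOpen_generateFrom_of_mem ⟨f, u, hu, rfl⟩
      rw [borel_eq_generateFrom_of_subbasis hS]
      refine MeasurableSpace.generateFrom_le ?_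
      rintro s ⟨f, u, hu, rfl⟩
      refine hu.measurableSet.preimage ?_
      have h : StronglyMeasurable (fun μ : ProbabilityMeasure X ↦ ∫ x, f x ∂(μ : Measure X)) :=
        f.continuous.stronglyMeasurable.integral_kernel (κ :=
          ⟨fun μ : ProbabilityMeasure X ↦ (μ : Measure X), measurable_subtype_coe⟩)
      exact h.measurable

/-! ### Finite measures as functionals on continuous functions -/

section
variable {X : Type*} [TopologicalSpace X] [CompactSpace X] [MeasurableSpace X]
  [OpensMeasurableSpace X]

theorem integrable_continuousMap (f : C(X, ℝ)) (m : Measure X) [IsFiniteMeasure m] :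
    Integrable f m :=
  (BoundedContinuousFunction.mkOfCompact f).integrable m

/-- The functional `f ↦ ∫ f dm` on `C(X, ℝ)` given by a finite measure `m`. -/
noncomputable def integralDual (m : Measure X) [IsFiniteMeasure m] : WeakDual ℝ C(X, ℝ) :=
  LinearMap.mkContinuous
    { toFun := fun f : C(X, ℝ) ↦ ∫ x, f x ∂m
      map_add' := fun f g ↦
        integral_add (integrable_continuousMap f m) (integrable_continuousMap g m)
      map_smul' := fun c f ↦ integral_const_mul c f }
    (m.real Set.univ) fun f ↦ by
      rw [mul_comm]
      exact norm_integral_le_of_norm_le_const (ae_of_all _ f.norm_coe_le_norm)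

end

/-- Finite measures on a compact metrizable space are equal if they give the same integrals to
a family of continuous functions that is closed under products and separates points. -/
theorem ext_of_integral_eq_on_submonoid {X : Type*} [TopologicalSpace X] [CompactSpace X]
    [MetrizableSpace X] [MeasurableSpace X] [BorelSpace X] {μ ν : Measure X} [IsFiniteMeasure μ]
    [IsFiniteMeasure ν] (G : Submonoid C(X, ℝ))
    (hG : ∀ x y, x ≠ y → ∃ g ∈ G, g x ≠ g y)
    (h : ∀ g ∈ G, ∫ x, g x ∂μ = ∫ x, g x ∂ν) : μ = ν := by
  have hspan : ∀ g ∈ Submodule.span ℝ (G : Set C(X, ℝ)), ∫ x, g x ∂μ = ∫ x, g x ∂ν := by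
    intro g hg
    induction hg using Submodule.span_induction with
    | mem g hg => exact h g hg
    | zero => simp
    | add f g _ _ hf hg =>
      simp only [ContinuousMap.add_apply]
      rw [integral_add (integrable_continuousMap f μ) (integrable_continuousMap g μ),
        integral_add (integrable_continuousMap f ν) (integrable_continuousMap g ν), hf, hg]
    | smul c f _ hf =>
      simp only [ContinuousMap.smul_apply, integral_smul, hf]
  have hcont (m : Measure X) [IsFiniteMeasure m] : Continuous fun f : C(X, ℝ) ↦ ∫ x, f x ∂m :=
    ContinuousLinearMap.continuous (integralDual m : C(X, ℝ) →L[ℝ] ℝ)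
  have htop := ContinuousMap.subalgebra_topologicalClosure_eq_top_of_separatesPoints
    (Algebra.adjoin ℝ (G : Set C(X, ℝ))) (by
      intro x y hxy
      obtain ⟨g, hg, hne⟩ := hG x y hxy
      exact ⟨g, ⟨g, Algebra.subset_adjoin hg, rfl⟩, hne⟩)
  have hall (g : C(X, ℝ)) : ∫ x, g x ∂μ = ∫ x, g x ∂ν := by
    have hg : g ∈ closure (Algebra.adjoin ℝ (G : Set C(X, ℝ)) : Set C(X, ℝ)) := by
      rw [← Subalgebra.topologicalClosure_coe, htop]; trivial
    refine closure_minimal (fun f hf ↦ ?_) (isClosed_eq (hcont μ) (hcont ν)) hg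
    -- As `G` is closed under products, the algebra it generates is just its linear span.
    refine hspan f ?_
    have : f ∈ Subalgebra.toSubmodule (Algebra.adjoin ℝ (G : Set C(X, ℝ))) := hf
    rwa [Algebra.adjoin_eq_span, Submonoid.closure_eq] at this
  exact ext_of_forall_integral_eq_of_IsFiniteMeasure fun f ↦ hall f.toContinuousMap

/-! ### Mixtures of Bernoulli measures and their moments -/

section
variable {K : Type*} [MeasurableSpace K]

/-- The Markov kernel sending `π` to the Bernoulli measure `π ^ ⊗ℤ`. -/
noncomputable def bernoulliKernel (K : Type*) [MeasurableSpace K] :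
    Kernel (ProbabilityMeasure K) (ℤ → K) where
  toFun π := Measure.infinitePi fun _ : ℤ ↦ (π : Measure K)
  measurable' := by
    refine Measurable.measure_of_isPiSystem_of_isProbabilityMeasure
      (generateFrom_squareCylinders (α := fun _ : ℤ ↦ K)).symm
      (isPiSystem_squareCylinders (fun _ ↦ MeasurableSpace.isPiSystem_measurableSet)
        fun _ ↦ MeasurableSet.univ) ?_
    rintro _ ⟨s, t, ht, rfl⟩
    simp only [Set.mem_pi, Set.mem_univ, forall_const, Set.mem_ofPred_eq] at ht
    simp_rw [Measure.infinitePi_pi _ (fun i _ ↦ ht i)]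
    exact Finset.measurable_prod _ fun i _ ↦
      (Measure.measurable_coe (ht i)).comp measurable_subtype_coe

theorem bernoulliKernel_apply (π : ProbabilityMeasure K) :
    bernoulliKernel K π = Measure.infinitePi fun _ : ℤ ↦ (π : Measure K) := rfl

instance : IsMarkovKernel (bernoulliKernel K) :=
  ⟨fun π ↦ by rw [bernoulliKernel_apply]; infer_instance⟩

end

section
variable {K : Type*} [TopologicalSpace K] [CompactSpace K] [MetrizableSpace K]
  [MeasurableSpace K] [BorelSpace K]

theorem integral_prod_bernoulliKernel (π : ProbabilityMeasure K) (s : Finset ℤ)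
    (f : ℤ → C(K, ℝ)) :
    ∫ ω, ∏ i ∈ s, f i (ω i) ∂(bernoulliKernel K π) = ∏ i ∈ s, ∫ x, f i x ∂(π : Measure K) := by
  rw [bernoulliKernel_apply]
  have := integral_restrict_infinitePi (μ := fun _ : ℤ ↦ (π : Measure K)) (s := s)
    (f := fun y : s → K ↦ ∏ i : s, f i (y i)) (by
      apply Measurable.aestronglyMeasurable
      exact Finset.measurable_prod _ fun i _ ↦
        (f i).continuous.measurable.comp (measurable_pi_apply i))
  rw [integral_fintype_prod_eq_prod (fun (i : s) x ↦ f i x)] at this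
  rw [← Finset.prod_coe_sort s fun i ↦ ∫ x, f i x ∂(π : Measure K), ← this]
  congr with ω
  rw [← Finset.prod_coe_sort]
  rfl

/-- The function `ω ↦ ∏ i ∈ s, f i (ω i)` on the product space. -/
def coordProd (s : Finset ℤ) (f : ℤ → C(K, ℝ)) : C(ℤ → K, ℝ) :=
  ⟨fun ω ↦ ∏ i ∈ s, f i (ω i), by fun_prop⟩

theorem integral_coordProd_comp (ν : Measure (ProbabilityMeasure K)) [IsFiniteMeasure ν]
    (s : Finset ℤ) (f : ℤ → C(K, ℝ)) :
    ∫ ω, ∏ i ∈ s, f i (ω i) ∂(bernoulliKernel K ∘ₘ ν) =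
      ∫ π, ∏ i ∈ s, ∫ x, f i x ∂(π : Measure K) ∂ν := by
  rw [Measure.comp_eq_comp_const_apply, Kernel.integral_comp]
  · simp_rw [integral_prod_bernoulliKernel, Kernel.const_apply]
  · exact (BoundedContinuousFunction.mkOfCompact (coordProd s f)).integrable _

/-- Finite measures on `K ^ ℤ` are determined by the integrals of products of functions of
single coordinates. -/
theorem ext_of_integral_coordProd {μ ν : Measure (ℤ → K)} [IsFiniteMeasure μ] [IsFiniteMeasure ν]
    (h : ∀ (s : Finset ℤ) (f : ℤ → C(K, ℝ)),
      ∫ ω, ∏ i ∈ s, f i (ω i) ∂μ = ∫ ω, ∏ i ∈ s, f i (ω i) ∂ν) : μ = ν := by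
  classical
  let G : Submonoid C(ℤ → K, ℝ) :=
    { carrier := {g | ∃ s f, g = coordProd s f}
      one_mem' := ⟨∅, 1, by ext; simp [coordProd]⟩
      mul_mem' := by
        rintro _ _ ⟨s, f, rfl⟩ ⟨t, g, rfl⟩
        -- Factors are padded with `1` outside `s` and outside `t`, so both products run over `s ∪
        -- t`.
        refine ⟨s ∪ t, fun i ↦ (if i ∈ s then f i else 1) * (if i ∈ t then g i else 1), ?_⟩
        ext ω
        simp only [coordProd, ContinuousMap.mul_apply, ContinuousMap.coe_mk,
          Finset.prod_mul_distrib]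
        congr 1
        · refine Finset.prod_subset_one_on_sdiff Finset.subset_union_left ?_ ?_
          · intro i hi; simp [(Finset.mem_sdiff.1 hi).2]
          · intro i hi; simp [hi]
        · refine Finset.prod_subset_one_on_sdiff Finset.subset_union_right ?_ ?_
          · intro i hi; simp [(Finset.mem_sdiff.1 hi).2]
          · intro i hi; simp [hi] }
  refine ext_of_integral_eq_on_submonoid G ?_ ?_
  · intro x y hxy
    obtain ⟨i, hi⟩ := Function.ne_iff.1 hxy
    let := metrizableSpaceMetric K
    refine ⟨_, ⟨{i}, fun _ ↦ ⟨fun z ↦ dist z (x i), by fun_prop⟩, rfl⟩, ?_⟩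
    simpa [coordProd] using hi.symm
  · rintro _ ⟨s, f, rfl⟩
    exact h s f

/-- The function `π ↦ ∫ f dπ` on the space of probability measures. -/
noncomputable def integralMap (f : C(K, ℝ)) : C(ProbabilityMeasure K, ℝ) :=
  ⟨fun π ↦ ∫ x, f x ∂(π : Measure K), ProbabilityMeasure.continuous_integral_continuousMap f⟩

/-- Finite measures on the space of probability measures on `K` are determined by their mixtures
of Bernoulli measures. -/
theorem eq_of_bernoulliKernel_comp_eq {ν ν' : Measure (ProbabilityMeasure K)} [IsFiniteMeasure ν]
    [IsFiniteMeasure ν'] (h : bernoulliKernel K ∘ₘ ν = bernoulliKernel K ∘ₘ ν') : ν = ν' := by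
  refine ext_of_integral_eq_on_submonoid (Submonoid.closure (Set.range integralMap)) ?_ ?_
  · intro π ρ hne
    by_contra! hcon
    refine hne (Subtype.ext (ext_of_forall_integral_eq_of_IsFiniteMeasure
      (μ := π.toMeasure) (ν := ρ.toMeasure) fun f ↦ ?_))
    exact hcon _ (Submonoid.subset_closure ⟨f.toContinuousMap, rfl⟩)
  · intro g hg
    have : ∃ (n : ℕ) (f : ℕ → C(K, ℝ)), ∀ π, g π = ∏ i ∈ Finset.range n, integralMap (f i) π := by
      induction hg using Submonoid.closure_induction_left with
      | one => exact ⟨0, 1, by simp⟩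
      | mul_left x hx y _ ih =>
        obtain ⟨f₀, rfl⟩ := hx
        obtain ⟨n, f, hf⟩ := ih
        refine ⟨n + 1, Function.update f n f₀, fun π ↦ ?_⟩
        rw [Finset.prod_range_succ, ContinuousMap.mul_apply, hf, mul_comm]
        congr 1
        · refine Finset.prod_congr rfl fun i hi ↦ ?_
          rw [Function.update_of_ne (Finset.mem_range.1 hi).ne]
        · rw [Function.update_self]
    obtain ⟨n, f, hf⟩ := this
    -- Factors of the monomial may repeat; placing them at the distinct coordinates `0, …, n - 1`
    -- makes them independent under each Bernoulli measure.
    have hmom (m : Measure (ProbabilityMeasure K)) [IsFiniteMeasure m] : ∫ π, g π ∂m =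
        ∫ ω, ∏ i ∈ (Finset.range n).map Nat.castEmbedding, f i.toNat (ω i)
          ∂(bernoulliKernel K ∘ₘ m) := by
      rw [integral_coordProd_comp m _ fun i ↦ f i.toNat]
      refine integral_congr_ae (ae_of_all _ fun π ↦ ?_)
      simp [hf, integralMap]
    rw [hmom, hmom, h]

end


/-! ### De Finetti's theorem -/

/-- An injection from a finite set of integers into `ℤ` extends to a permutation of `ℤ` moving
only finitely many integers. -/
theorem exists_perm_extending {s : Finset ℤ} {p : s → ℤ} (hp : Function.Injective p) :
    ∃ σ : Equiv.Perm ℤ, {n : ℤ | σ n ≠ n}.Finite ∧ ∀ i : s, σ i = p i := by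
  classical
  let t : Finset ℤ := s ∪ Finset.univ.image p
  let f : t → ℤ := fun x ↦ if h : (x : ℤ) ∈ s then p ⟨x, h⟩ else 0
  have hfs : Set.InjOn f (Finset.univ.filter fun x : t ↦ (x : ℤ) ∈ s) := by
    intro x hx y hy hxy
    simp only [Finset.coe_filter, Finset.mem_univ, true_and, Set.mem_ofPred_eq] at hx hy
    simp only [f, hx, hy, dif_pos] at hxy
    exact Subtype.ext (Subtype.mk.inj (hp hxy))
  have hft : (Finset.univ.filter fun x : t ↦ (x : ℤ) ∈ s).image f ⊆ t := by
    intro y hy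
    obtain ⟨x, hx, rfl⟩ := Finset.mem_image.1 hy
    have hx : (x : ℤ) ∈ s := by simpa using hx
    simp only [f, hx, dif_pos]
    exact Finset.mem_union_right _ (Finset.mem_image_of_mem _ (Finset.mem_univ _))
  -- The partial injection has domain and range in the finite set `t`, so it completes to a
  -- bijection of `t`; outside `t` the permutation is the identity.
  obtain ⟨g, hg⟩ := Finset.exists_equiv_extend_of_card_eq (Fintype.card_coe t) hft hfs
  refine ⟨Equiv.Perm.ofSubtype (p := (· ∈ t)) g, t.finite_toSet.subset ?_, fun i ↦ ?_⟩
  · intro n hn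
    by_contra h
    exact hn (Equiv.Perm.ofSubtype_apply_of_not_mem _ h)
  · have hi : (i : ℤ) ∈ t := Finset.mem_union_left _ i.2
    rw [Equiv.Perm.ofSubtype_apply_of_mem (p := (· ∈ t)) g hi, hg ⟨i, hi⟩ (by simp)]
    simp [f]

section
variable {K : Type*} [MeasurableSpace K]

theorem measurable_permute (σ : Equiv.Perm ℤ) : Measurable fun (ω : ℤ → K) n ↦ ω (σ n) :=
  measurable_pi_lambda _ fun n ↦ measurable_pi_apply (σ n)

/-- The empirical measure of the coordinates `0, …, n` of a sequence. -/
noncomputable def empiricalMeasure (n : ℕ) (ω : ℤ → K) : ProbabilityMeasure K :=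
  ⟨((n + 1 : ℕ) : ENNReal)⁻¹ • ∑ j : Fin (n + 1), Measure.dirac (ω j), ⟨by
    simp only [Measure.smul_apply, Measure.finsetSum_apply, measure_univ, Finset.sum_const,
      Finset.card_univ, Fintype.card_fin, smul_eq_mul, nsmul_eq_mul, mul_one]
    exact ENNReal.inv_mul_cancel (by simp) (by simp)⟩⟩

theorem measurable_empiricalMeasure (n : ℕ) :
    Measurable (empiricalMeasure n : (ℤ → K) → ProbabilityMeasure K) := by
  refine Measurable.subtype_mk (Measure.measurable_of_measurable_coe _ fun s hs ↦ ?_)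
  simp only [Measure.smul_apply, Measure.finsetSum_apply, smul_eq_mul]
  refine Measurable.const_mul (Finset.measurable_sum _ fun j _ ↦ ?_) _
  exact ((Measure.measurable_coe hs).comp Measure.measurable_dirac).comp
    (measurable_pi_apply (j : ℤ))

end

theorem abs_integral_prod_le {K : Type*} [TopologicalSpace K] [CompactSpace K]
    [MeasurableSpace K] {μ : ProbabilityMeasure (ℤ → K)} {s : Finset ℤ} (f : ℤ → C(K, ℝ)) (p : s → ℤ) :
    |∫ ω, ∏ i : s, f i (ω (p i)) ∂(μ : Measure (ℤ → K))| ≤ ∏ i : s, ‖f i‖ := by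
  have h (ω : ℤ → K) : ‖∏ i : s, f i (ω (p i))‖ ≤ ∏ i : s, ‖f i‖ := by
    rw [norm_prod]
    exact Finset.prod_le_prod (fun _ _ ↦ norm_nonneg _) fun i _ ↦ (f i).norm_coe_le_norm _
  simpa using norm_integral_le_of_norm_le_const (μ := (μ : Measure (ℤ → K))) (ae_of_all _ h)

section
variable {K : Type*} [TopologicalSpace K] [CompactSpace K] [MetrizableSpace K]
  [MeasurableSpace K] [BorelSpace K]

theorem integral_empiricalMeasure (n : ℕ) (ω : ℤ → K) (f : C(K, ℝ)) :
    ∫ x, f x ∂(empiricalMeasure n ω : Measure K) =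
      ((n + 1 : ℕ) : ℝ)⁻¹ * ∑ j : Fin (n + 1), f (ω j) := by
  change ∫ x, f x ∂(((n + 1 : ℕ) : ENNReal)⁻¹ • ∑ j : Fin (n + 1), Measure.dirac (ω j)) = _
  rw [integral_smul_measure, integral_finsetSum_measure fun j _ ↦ integrable_continuousMap f _]
  simp [-Nat.cast_add]

variable {μ : ProbabilityMeasure (ℤ → K)}

theorem integral_prod_comp_injective (hμ : μ ∈ exchangeableMeasures K) {s : Finset ℤ}
    (f : ℤ → C(K, ℝ)) {p : s → ℤ} (hp : Function.Injective p) :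
    ∫ ω, ∏ i : s, f i (ω (p i)) ∂(μ : Measure (ℤ → K)) =
      ∫ ω, ∏ i ∈ s, f i (ω i) ∂(μ : Measure (ℤ → K)) := by
  obtain ⟨σ, hσ, hσp⟩ := exists_perm_extending hp
  conv_rhs => rw [← hμ σ hσ]
  rw [integral_map (f := fun ω ↦ ∏ i ∈ s, f i (ω i)) (measurable_permute σ).aemeasurable
    (coordProd s f).continuous.measurable.aestronglyMeasurable]
  simp_rw [← hσp, ← Finset.prod_coe_sort s]

theorem card_not_injective (ι : Type*) [Fintype ι] [DecidableEq ι] (N : ℕ) :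
    ((Finset.univ.filter fun p : ι → Fin N ↦ ¬ Function.Injective p).card : ℝ) =
      (N : ℝ) ^ Fintype.card ι - N.descFactorial (Fintype.card ι) := by
  have h := Finset.card_filter_add_card_filter_not (s := (Finset.univ : Finset (ι → Fin N)))
    (fun p ↦ Function.Injective p)
  have h' : (Finset.univ.filter fun p : ι → Fin N ↦ Function.Injective p).card =
      N.descFactorial (Fintype.card ι) := by
    rw [← Fintype.card_subtype, Fintype.card_congr (Equiv.subtypeInjectiveEquivEmbedding ι (Fin N)),
      Fintype.card_embedding_eq, Fintype.card_fin]
  rw [h', Finset.card_univ, Fintype.card_fun, Fintype.card_fin] at h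
  rw [eq_sub_iff_add_eq, add_comm]
  exact_mod_cast h

/-- The moments of the empirical measures of an exchangeable measure converge. -/
theorem tendsto_integral_prod_empiricalMeasure (hμ : μ ∈ exchangeableMeasures K) (s : Finset ℤ)
    (f : ℤ → C(K, ℝ)) :
    Tendsto (fun n ↦ ∫ ω, ∏ i ∈ s, ∫ x, f i x ∂(empiricalMeasure n ω : Measure K)
      ∂(μ : Measure (ℤ → K))) atTop (𝓝 (∫ ω, ∏ i ∈ s, f i (ω i) ∂(μ : Measure (ℤ → K)))) := by
  classical
  set M := ∫ ω, ∏ i ∈ s, f i (ω i) ∂(μ : Measure (ℤ → K)) with hM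
  set C := ∏ i : s, ‖f i‖ with hC
  have hMC : |M| ≤ C := by
    simpa only [hM, ← Finset.prod_coe_sort s] using abs_integral_prod_le (μ := μ) f Subtype.val
  let I (N : ℕ) (p : s → Fin N) : ℝ := ∫ ω, ∏ i : s, f i (ω (p i)) ∂(μ : Measure (ℤ → K))
  have hexpand (n : ℕ) : ∫ ω, ∏ i ∈ s, ∫ x, f i x ∂(empiricalMeasure n ω : Measure K)
      ∂(μ : Measure (ℤ → K)) = (((n + 1 : ℕ) : ℝ) ^ s.card)⁻¹ * ∑ p, I (n + 1) p := by
    simp_rw [integral_empiricalMeasure, Finset.prod_mul_distrib, Finset.prod_const, inv_pow]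
    rw [integral_const_mul]
    congr 1
    simp_rw [← Finset.prod_coe_sort s]
    simp_rw [Finset.prod_univ_sum, Fintype.piFinset_univ]
    refine integral_finsetSum _ fun p _ ↦ ?_
    exact integrable_continuousMap
      ⟨fun ω : ℤ → K ↦ ∏ i : s, f i (ω (p i)), by fun_prop⟩ (μ : Measure (ℤ → K))
  -- Injective index maps contribute no error, the others at most `2 * C` each; the last factor is
  -- the proportion of non-injective maps.
  have hbound (n : ℕ) : |(((n + 1 : ℕ) : ℝ) ^ s.card)⁻¹ * ∑ p, I (n + 1) p - M| ≤
      2 * C * (1 - ((n + 1).descFactorial s.card : ℝ) / ((n + 1 : ℕ) : ℝ) ^ s.card) := by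
    have hpos : (0 : ℝ) < ((n + 1 : ℕ) : ℝ) ^ s.card := by positivity
    have hcard : ((n + 1 : ℕ) : ℝ) ^ s.card * M = ∑ _p : s → Fin (n + 1), M := by
      rw [Finset.sum_const, Finset.card_univ, Fintype.card_fun, Fintype.card_fin,
        Fintype.card_coe, nsmul_eq_mul]
      push_cast
      rfl
    have hle : |∑ p, I (n + 1) p - ((n + 1 : ℕ) : ℝ) ^ s.card * M| ≤
        2 * C * (((n + 1 : ℕ) : ℝ) ^ s.card - (n + 1).descFactorial s.card) := by
      rw [hcard, ← Finset.sum_sub_distrib]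
      refine (Finset.abs_sum_le_sum_abs _ _).trans ?_
      have hterm (p : s → Fin (n + 1)) :
          |I (n + 1) p - M| ≤ if ¬ Function.Injective p then 2 * C else 0 := by
        by_cases h : Function.Injective p
        · have hinj : Function.Injective fun i ↦ ((p i : ℕ) : ℤ) :=
            (Nat.cast_injective.comp Fin.val_injective).comp h
          rw [if_neg (not_not.2 h)]
          simp only [I]
          rw [integral_prod_comp_injective hμ f hinj, sub_self, abs_zero]
        · have : |I (n + 1) p| ≤ C := abs_integral_prod_le (μ := μ) f fun i ↦ ((p i : ℕ) : ℤ)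
          rw [if_pos h]
          exact (abs_sub _ _).trans (by linarith)
      refine (Finset.sum_le_sum fun p _ ↦ hterm p).trans_eq ?_
      have hc := card_not_injective s (n + 1)
      rw [Fintype.card_coe] at hc
      rw [← Finset.sum_filter, Finset.sum_const, nsmul_eq_mul, hc, mul_comm]
    have heq : (((n + 1 : ℕ) : ℝ) ^ s.card)⁻¹ * ∑ p, I (n + 1) p - M =
        (∑ p, I (n + 1) p - ((n + 1 : ℕ) : ℝ) ^ s.card * M) / ((n + 1 : ℕ) : ℝ) ^ s.card := by
      field_simp
    rw [heq, abs_div, abs_of_pos hpos, div_le_iff₀ hpos]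
    refine hle.trans_eq ?_
    field_simp
  have hlim : Tendsto (fun n : ℕ ↦ 2 * C *
      (1 - ((n + 1).descFactorial s.card : ℝ) / ((n + 1 : ℕ) : ℝ) ^ s.card)) atTop (𝓝 0) := by
    have h1 : Tendsto (fun n : ℕ ↦ (n.descFactorial s.card : ℝ) / (n : ℝ) ^ s.card) atTop
        (𝓝 1) := by
      refine (Asymptotics.isEquivalent_iff_tendsto_one ?_).1 (isEquivalent_descFactorial s.card)
      filter_upwards [eventually_gt_atTop 0] with n hn
      positivity
    have h2 := ((h1.comp (tendsto_add_atTop_nat 1)).const_sub 1).const_mul (2 * C)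
    simpa using h2
  rw [tendsto_iff_dist_tendsto_zero]
  refine squeeze_zero (fun _ ↦ dist_nonneg) (fun n ↦ ?_) hlim
  rw [hexpand, Real.dist_eq]
  exact hbound n

/-- **De Finetti's theorem**: an exchangeable measure is a mixture of Bernoulli measures. -/
theorem exists_bernoulliKernel_comp_eq (hμ : μ ∈ exchangeableMeasures K) :
    ∃ ν : ProbabilityMeasure (ProbabilityMeasure K),
      bernoulliKernel K ∘ₘ (ν : Measure (ProbabilityMeasure K)) = μ := by
  let η (n : ℕ) : ProbabilityMeasure (ProbabilityMeasure K) :=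
    μ.map (measurable_empiricalMeasure n).aemeasurable
  -- By compactness the laws converge along a free ultrafilter, so no subsequence is needed.
  let U : Ultrafilter (ProbabilityMeasure (ProbabilityMeasure K)) := (hyperfilter ℕ).map η
  have : Nonempty (ProbabilityMeasure (ProbabilityMeasure K)) := ⟨η 0⟩
  have hU : Tendsto η (hyperfilter ℕ) (𝓝 U.lim) := U.le_nhds_lim
  refine ⟨U.lim, ext_of_integral_coordProd fun s f ↦ ?_⟩
  rw [integral_coordProd_comp]
  let F : C(ProbabilityMeasure K, ℝ) := ∏ i ∈ s, integralMap (f i)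
  have hF (π : ProbabilityMeasure K) : F π = ∏ i ∈ s, ∫ x, f i x ∂(π : Measure K) := by
    simp [F, integralMap]
  have h1 := (ProbabilityMeasure.continuous_integral_continuousMap F).continuousAt.tendsto.comp hU
  have h2 := (tendsto_integral_prod_empiricalMeasure hμ s f).mono_left
    (Nat.hyperfilter_le_atTop)
  refine tendsto_nhds_unique (by simpa only [hF] using h1) (h2.congr fun n ↦ ?_)
  simp only [Function.comp, η, ProbabilityMeasure.toMeasure_map, ← hF]
  exact (integral_map (measurable_empiricalMeasure n).aemeasurable
    F.continuous.measurable.aestronglyMeasurable).symm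

end


/-! ### The cone over the exchangeable measures and its lattice order -/

theorem bernoulliKernel_comp_mem_exchangeableMeasures {K : Type*} [MeasurableSpace K]
    {μ : ProbabilityMeasure (ℤ → K)} {ν : Measure (ProbabilityMeasure K)}
    (h : bernoulliKernel K ∘ₘ ν = μ) : μ ∈ exchangeableMeasures K := by
  intro σ _
  rw [← h, Measure.map_comp _ _ (measurable_permute σ)]
  congr 1
  ext1 π
  rw [Kernel.map_apply _ (measurable_permute σ), bernoulliKernel_apply]
  exact Measure.map_infinitePi_infinitePi_of_inj (P := fun _ : ℤ ↦ (π : Measure K)) σ.injective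

section
variable {K : Type*} [TopologicalSpace K] [CompactSpace K] [MetrizableSpace K]
  [MeasurableSpace K] [BorelSpace K]

variable (K) in
theorem isClosed_exchangeableMeasures : IsClosed (exchangeableMeasures K) := by
  simp only [exchangeableMeasures, Set.ofPred_forall]
  refine isClosed_iInter fun σ ↦ isClosed_iInter fun _ ↦ ?_
  have hσ : Continuous fun (ω : ℤ → K) n ↦ ω (σ n) := by fun_prop
  convert isClosed_eq (ProbabilityMeasure.continuous_map hσ) continuous_id using 3
  rw [← ProbabilityMeasure.toMeasure_injective.eq_iff]
  rfl

theorem continuous_integralDual {X : Type*} [TopologicalSpace X] [CompactSpace X]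
    [MeasurableSpace X] [OpensMeasurableSpace X] :
    Continuous fun μ : ProbabilityMeasure X ↦ integralDual μ.toMeasure :=
  WeakDual.continuous_of_continuous_eval fun f ↦
    ProbabilityMeasure.continuous_integral_continuousMap f

theorem asFunctionals_eq_image {X : Type*} [TopologicalSpace X] [CompactSpace X]
    [MeasurableSpace X] [OpensMeasurableSpace X] (S : Set (ProbabilityMeasure X)) :
    asFunctionals S = (fun μ ↦ integralDual μ.toMeasure) '' S := by
  ext φ
  refine exists_congr fun μ ↦ and_congr_right fun _ ↦ ?_
  exact ⟨fun h ↦ (ContinuousLinearMap.ext h).symm, fun h f ↦ by rw [← h]; rfl⟩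

/-- The functional and the total mass of the mixture of Bernoulli measures with weight `ν`. -/
noncomputable def mixtureFunctional (ν : FiniteMeasure (ProbabilityMeasure K)) :
    WeakDual ℝ C(ℤ → K, ℝ) × ℝ :=
  (integralDual (bernoulliKernel K ∘ₘ (ν : Measure (ProbabilityMeasure K))), ν.mass)

theorem mixtureFunctional_add (ν ν' : FiniteMeasure (ProbabilityMeasure K)) :
    mixtureFunctional (ν + ν') = mixtureFunctional ν + mixtureFunctional ν' := by
  refine Prod.ext (ContinuousLinearMap.ext fun f ↦ ?_) ?_
  · change ∫ ω, f ω ∂_ = ∫ ω, f ω ∂_ + ∫ ω, f ω ∂_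
    rw [FiniteMeasure.toMeasure_add, Measure.comp_add,
      integral_add_measure (integrable_continuousMap f _) (integrable_continuousMap f _)]
  · simp [mixtureFunctional, FiniteMeasure.mass]

theorem mixtureFunctional_smul (c : NNReal) (ν : FiniteMeasure (ProbabilityMeasure K)) :
    mixtureFunctional (c • ν) = (c : ℝ) • mixtureFunctional ν := by
  refine Prod.ext (ContinuousLinearMap.ext fun f ↦ ?_) ?_
  · change ∫ ω, f ω ∂_ = (c : ℝ) * ∫ ω, f ω ∂_
    have : ((c • ν : FiniteMeasure (ProbabilityMeasure K)) : Measure (ProbabilityMeasure K)) =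
      (c : ENNReal) • (ν : Measure (ProbabilityMeasure K)) := rfl
    rw [this, Measure.comp_smul, integral_smul_measure]
    rfl
  · simp [mixtureFunctional, FiniteMeasure.mass]

theorem mixtureFunctional_toNNReal_smul {c : ℝ} (hc : 0 ≤ c)
    (ν : FiniteMeasure (ProbabilityMeasure K)) :
    mixtureFunctional (c.toNNReal • ν) = c • mixtureFunctional ν := by
  rw [mixtureFunctional_smul, Real.coe_toNNReal c hc]

theorem mixtureFunctional_zero :
    mixtureFunctional (0 : FiniteMeasure (ProbabilityMeasure K)) = 0 := by
  simpa using mixtureFunctional_smul 0 (0 : FiniteMeasure (ProbabilityMeasure K))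

theorem mixtureFunctional_injective :
    Function.Injective (mixtureFunctional : FiniteMeasure (ProbabilityMeasure K) → _) := by
  intro ν ν' h
  refine FiniteMeasure.toMeasure_injective (eq_of_bernoulliKernel_comp_eq ?_)
  refine ext_of_forall_integral_eq_of_IsFiniteMeasure fun f ↦ ?_
  exact DFunLike.congr_fun (congrArg Prod.fst h) f.toContinuousMap

theorem mem_asFunctionals_exchangeableMeasures {φ : WeakDual ℝ C(ℤ → K, ℝ)} :
    φ ∈ asFunctionals (exchangeableMeasures K) ↔
      ∃ ν : FiniteMeasure (ProbabilityMeasure K), mixtureFunctional ν = (φ, 1) := by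
  rw [asFunctionals_eq_image]
  constructor
  · rintro ⟨μ, hμ, rfl⟩
    obtain ⟨ν, hν⟩ := exists_bernoulliKernel_comp_eq hμ
    refine ⟨ν.toFiniteMeasure, Prod.ext ?_ (by simp [mixtureFunctional])⟩
    change integralDual (bernoulliKernel K ∘ₘ (ν : Measure (ProbabilityMeasure K))) = _
    simp_rw [hν]
  · rintro ⟨ν, hν⟩
    have hmass : ν.mass = 1 := NNReal.coe_injective (congrArg Prod.snd hν)
    have : IsProbabilityMeasure (ν : Measure (ProbabilityMeasure K)) :=
      ⟨by rw [← FiniteMeasure.ennreal_mass, hmass, ENNReal.coe_one]⟩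
    let μ : ProbabilityMeasure (ℤ → K) :=
      ⟨bernoulliKernel K ∘ₘ (ν : Measure (ProbabilityMeasure K)), inferInstance⟩
    exact ⟨μ, bernoulliKernel_comp_mem_exchangeableMeasures rfl, congrArg Prod.fst hν⟩

theorem mixtureFunctional_mem_coneOver (ν : FiniteMeasure (ProbabilityMeasure K)) :
    mixtureFunctional ν ∈ coneOver (asFunctionals (exchangeableMeasures K)) := by
  rcases eq_or_ne ν.mass 0 with h | h
  · rw [(FiniteMeasure.mass_zero_iff ν).1 h, mixtureFunctional_zero]
    exact zero_mem _
  · have h' : (ν.mass : ℝ) ≠ 0 := by exact_mod_cast h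
    have hmem : mixtureFunctional (ν.mass⁻¹ • ν) ∈
        asFunctionals (exchangeableMeasures K) ×ˢ {(1 : ℝ)} := by
      have h1 : (mixtureFunctional (ν.mass⁻¹ • ν)).2 = 1 := by
        rw [mixtureFunctional_smul, NNReal.coe_inv]
        exact inv_mul_cancel₀ h'
      exact ⟨mem_asFunctionals_exchangeableMeasures.2 ⟨ν.mass⁻¹ • ν, Prod.ext rfl h1⟩, h1⟩
    have hν : mixtureFunctional ν = (ν.mass : ℝ) • mixtureFunctional (ν.mass⁻¹ • ν) := by
      rw [mixtureFunctional_smul, smul_smul, NNReal.coe_inv, mul_inv_cancel₀ h', one_smul]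
    rw [hν]
    exact Submodule.smul_mem (coneOver (asFunctionals (exchangeableMeasures K)))
      (⟨(ν.mass : ℝ), ν.mass.coe_nonneg⟩ : {c : ℝ // 0 ≤ c}) (Submodule.subset_span hmem)

/-- With `mixtureFunctional_injective`, this identifies the cone with the finite positive measures
on the space of probability measures on `K`. -/
theorem mem_coneOver_exchangeableMeasures {u : WeakDual ℝ C(ℤ → K, ℝ) × ℝ} :
    u ∈ coneOver (asFunctionals (exchangeableMeasures K)) ↔
      ∃ ν : FiniteMeasure (ProbabilityMeasure K), mixtureFunctional ν = u := by
  refine ⟨fun hu ↦ ?_, ?_⟩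
  · induction hu using Submodule.span_induction with
    | mem u hu =>
      obtain ⟨ν, hν⟩ := mem_asFunctionals_exchangeableMeasures.1 hu.1
      exact ⟨ν, hν.trans (Prod.ext rfl hu.2.symm)⟩
    | zero => exact ⟨0, mixtureFunctional_zero⟩
    | add u v _ _ hu hv =>
      obtain ⟨ν, rfl⟩ := hu
      obtain ⟨ν', rfl⟩ := hv
      exact ⟨ν + ν', mixtureFunctional_add ν ν'⟩
    | smul c u _ hu =>
      obtain ⟨ν, rfl⟩ := hu
      exact ⟨(c : ℝ).toNNReal • ν, mixtureFunctional_toNNReal_smul c.2 ν⟩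
  · rintro ⟨ν, rfl⟩
    exact mixtureFunctional_mem_coneOver ν

theorem exists_eq_sub_of_mem_span {u : WeakDual ℝ C(ℤ → K, ℝ) × ℝ}
    (hu : u ∈ Submodule.span ℝ (asFunctionals (exchangeableMeasures K) ×ˢ {(1 : ℝ)})) :
    ∃ ν ν' : FiniteMeasure (ProbabilityMeasure K),
      u = mixtureFunctional ν - mixtureFunctional ν' := by
  induction hu using Submodule.span_induction with
  | mem u hu =>
    obtain ⟨ν, hν⟩ := mem_coneOver_exchangeableMeasures.1 (Submodule.subset_span hu)
    exact ⟨ν, 0, by rw [hν, mixtureFunctional_zero, sub_zero]⟩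
  | zero => exact ⟨0, 0, (sub_self _).symm⟩
  | add u v _ _ hu hv =>
    obtain ⟨ν₁, ν₂, rfl⟩ := hu
    obtain ⟨ν₃, ν₄, rfl⟩ := hv
    refine ⟨ν₁ + ν₃, ν₂ + ν₄, ?_⟩
    rw [mixtureFunctional_add, mixtureFunctional_add]
    abel
  | smul c u _ hu =>
    obtain ⟨ν, ν', rfl⟩ := hu
    rcases le_total 0 c with hc | hc
    · refine ⟨c.toNNReal • ν, c.toNNReal • ν', ?_⟩
      rw [mixtureFunctional_toNNReal_smul hc, mixtureFunctional_toNNReal_smul hc, smul_sub]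
    · have hc' : 0 ≤ -c := neg_nonneg.2 hc
      refine ⟨(-c).toNNReal • ν', (-c).toNNReal • ν, ?_⟩
      have hneg (x : WeakDual ℝ C(ℤ → K, ℝ) × ℝ) : (-c) • x = -(c • x) := neg_smul c x
      rw [mixtureFunctional_toNNReal_smul hc', mixtureFunctional_toNNReal_smul hc', smul_sub,
        hneg, hneg]
      abel

theorem coneOver_le_span {E : Type*} [AddCommGroup E] [Module ℝ E] {X : Set E} {u : E × ℝ}
    (hu : u ∈ coneOver X) : u ∈ Submodule.span ℝ (X ×ˢ {(1 : ℝ)}) := by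
  induction hu using Submodule.span_induction with
  | mem u hu => exact Submodule.subset_span hu
  | zero => exact zero_mem _
  | add u v _ _ hu hv => exact add_mem hu hv
  | smul c u _ hu => exact Submodule.smul_mem _ (c : ℝ) hu

theorem mixtureFunctional_sub_mem_coneOver {ν ν' : FiniteMeasure (ProbabilityMeasure K)}
    (h : (ν : Measure (ProbabilityMeasure K)) ≤ ν') :
    mixtureFunctional ν' - mixtureFunctional ν ∈
      coneOver (asFunctionals (exchangeableMeasures K)) := by
  let ρ : FiniteMeasure (ProbabilityMeasure K) :=
    ⟨(ν' : Measure (ProbabilityMeasure K)) - ν, inferInstance⟩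
  have hρ : ν' = ρ + ν :=
    FiniteMeasure.toMeasure_injective (Measure.sub_add_cancel_of_le h).symm
  rw [hρ, mixtureFunctional_add, add_sub_cancel_right]
  exact mixtureFunctional_mem_coneOver ρ

variable (K) in
theorem isChoquetSimplex_exchangeableMeasures :
    IsChoquetSimplex (asFunctionals (exchangeableMeasures K)) where
  convex := by
    intro x hx y hy a b ha hb hab
    obtain ⟨ν, hν⟩ := mem_asFunctionals_exchangeableMeasures.1 hx
    obtain ⟨ν', hν'⟩ := mem_asFunctionals_exchangeableMeasures.1 hy
    refine mem_asFunctionals_exchangeableMeasures.2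
      ⟨a.toNNReal • ν + b.toNNReal • ν', ?_⟩
    rw [mixtureFunctional_add, mixtureFunctional_toNNReal_smul ha,
      mixtureFunctional_toNNReal_smul hb, hν, hν']
    simp [hab]
  isCompact := by
    rw [asFunctionals_eq_image]
    exact (isClosed_exchangeableMeasures K).isCompact.image continuous_integralDual
  exists_sup := by
    intro u hu v hv
    obtain ⟨a, b, rfl⟩ := exists_eq_sub_of_mem_span hu
    obtain ⟨c, d, rfl⟩ := exists_eq_sub_of_mem_span hv
    -- Adding `b + d` to both elements moves them into the cone, where the supremum is that of the
    -- measures `α` and `β`.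
    let α := a + d
    let β := c + b
    have hle : (α : Measure (ProbabilityMeasure K)) ⊔ β ≤ α + β :=
      sup_le (Measure.le_add_right le_rfl) (Measure.le_add_left le_rfl)
    let γ : FiniteMeasure (ProbabilityMeasure K) :=
      ⟨(α : Measure (ProbabilityMeasure K)) ⊔ β, isFiniteMeasure_of_le _ hle⟩
    have hα : mixtureFunctional a - mixtureFunctional b =
        mixtureFunctional α - mixtureFunctional (b + d) := by
      rw [mixtureFunctional_add, mixtureFunctional_add]
      abel
    have hβ : mixtureFunctional c - mixtureFunctional d =
        mixtureFunctional β - mixtureFunctional (b + d) := by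
      rw [mixtureFunctional_add, mixtureFunctional_add]
      abel
    rw [hα, hβ]
    refine ⟨mixtureFunctional γ - mixtureFunctional (b + d), ?_, ?_, ?_, ?_⟩
    · exact sub_mem (coneOver_le_span (mixtureFunctional_mem_coneOver _))
        (coneOver_le_span (mixtureFunctional_mem_coneOver _))
    · rw [sub_sub_sub_cancel_right]
      exact mixtureFunctional_sub_mem_coneOver (le_sup_left (α := Measure _))
    · rw [sub_sub_sub_cancel_right]
      exact mixtureFunctional_sub_mem_coneOver (le_sup_right (α := Measure _))
    · intro z _ hzα hzβ
      obtain ⟨p, hp⟩ := mem_coneOver_exchangeableMeasures.1 hzα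
      obtain ⟨q, hq⟩ := mem_coneOver_exchangeableMeasures.1 hzβ
      have hpα : mixtureFunctional (p + α) = z + mixtureFunctional (b + d) := by
        rw [mixtureFunctional_add, hp]
        abel
      have hqβ : mixtureFunctional (q + β) = z + mixtureFunctional (b + d) := by
        rw [mixtureFunctional_add, hq]
        abel
      -- By injectivity, the shifted upper bound comes from a single measure dominating both `α` and
      -- `β`, hence `γ`.
      have hpq : q + β = p + α := mixtureFunctional_injective (hqβ.trans hpα.symm)
      have hγ : (γ : Measure (ProbabilityMeasure K)) ≤ (p + α : FiniteMeasure _) := by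
        refine sup_le (Measure.le_add_left le_rfl) ?_
        rw [← hpq]
        exact Measure.le_add_left le_rfl
      have hz : z - (mixtureFunctional γ - mixtureFunctional (b + d)) =
          mixtureFunctional (p + α) - mixtureFunctional γ := by
        rw [hpα]
        abel
      rw [hz]
      exact mixtureFunctional_sub_mem_coneOver hγ

end

/-! ### Barycenters of measures carried by the Bernoulli measures -/

section
variable (K : Type*) [MeasurableSpace K]

/-- The Bernoulli measure `π ^ ⊗ℤ` as a probability measure. -/
noncomputable def bernoulliProduct (π : ProbabilityMeasure K) : ProbabilityMeasure (ℤ → K) :=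
  ⟨bernoulliKernel K π, inferInstance⟩

theorem measurable_bernoulliProduct : Measurable (bernoulliProduct K) :=
  (bernoulliKernel K).measurable.subtype_mk

/-- The law of the coordinate of index `0`. -/
noncomputable def zeroMarginal (ξ : ProbabilityMeasure (ℤ → K)) : ProbabilityMeasure K :=
  ξ.map (measurable_pi_apply 0).aemeasurable

theorem measurable_zeroMarginal : Measurable (zeroMarginal K) :=
  ((Measure.measurable_map _ (measurable_pi_apply 0)).comp measurable_subtype_coe).subtype_mk

theorem zeroMarginal_bernoulliProduct (π : ProbabilityMeasure K) :
    zeroMarginal K (bernoulliProduct K π) = π :=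
  Subtype.ext (Measure.infinitePi_map_eval (fun _ : ℤ ↦ (π : Measure K)) 0)

/-- A product measure is recovered from its marginal; as a fixed-point set, `Ber` is seen to be
measurable. -/
theorem mem_bernoulliMeasures {ξ : ProbabilityMeasure (ℤ → K)} :
    ξ ∈ bernoulliMeasures K ↔ bernoulliProduct K (zeroMarginal K ξ) = ξ := by
  constructor
  · rintro ⟨π, hπ⟩
    obtain rfl : ξ = bernoulliProduct K π := Subtype.ext hπ
    rw [zeroMarginal_bernoulliProduct]
  · exact fun h ↦ ⟨zeroMarginal K ξ, congrArg Subtype.val h.symm⟩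

theorem isBarycenter_map_bernoulliProduct {ν : Measure (ProbabilityMeasure K)}
    {μ : ProbabilityMeasure (ℤ → K)} :
    IsBarycenter (ν.map (bernoulliProduct K)) μ ↔ bernoulliKernel K ∘ₘ ν = μ := by
  have h (A : Set (ℤ → K)) (hA : MeasurableSet A) :
      ∫⁻ ξ : ProbabilityMeasure (ℤ → K), (ξ : Measure (ℤ → K)) A ∂ν.map (bernoulliProduct K) =
        (bernoulliKernel K ∘ₘ ν) A := by
    have hm : Measurable fun ξ : ProbabilityMeasure (ℤ → K) ↦ (ξ : Measure (ℤ → K)) A :=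
      (Measure.measurable_coe hA).comp measurable_subtype_coe
    rw [lintegral_map hm (measurable_bernoulliProduct K), Measure.bind_apply hA (Kernel.aemeasurable _)]
    rfl
  constructor
  · exact fun hμ ↦ Measure.ext fun A hA ↦ by rw [hμ A hA, h A hA]
  · exact fun hμ A hA ↦ by rw [h A hA, hμ]

end

theorem corollary3 (K : Type*) [TopologicalSpace K] [CompactSpace K]
    [TopologicalSpace.MetrizableSpace K] [MeasurableSpace K] [BorelSpace K] :
    IsChoquetSimplex (asFunctionals (exchangeableMeasures K)) ∧
    ∀ μ ∈ exchangeableMeasures K,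
      ∃! η : Measure (ProbabilityMeasure (ℤ → K)),
        IsProbabilityMeasure η ∧ η (bernoulliMeasures K)ᶜ = 0 ∧ IsBarycenter η μ := by
  refine ⟨isChoquetSimplex_exchangeableMeasures K, fun μ hμ ↦ ?_⟩
  obtain ⟨ν, hν⟩ := exists_bernoulliKernel_comp_eq hμ
  have hmeas : MeasurableSet (bernoulliMeasures K) := by
    have : bernoulliMeasures K = {ξ | bernoulliProduct K (zeroMarginal K ξ) = ξ} :=
      Set.ext fun ξ ↦ mem_bernoulliMeasures K
    rw [this]
    have : OpensMeasurableSpace (ProbabilityMeasure (ℤ → K) × ProbabilityMeasure (ℤ → K)) :=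
      Prod.opensMeasurableSpace
    have hd : MeasurableSet (Set.diagonal (ProbabilityMeasure (ℤ → K))) :=
      isClosed_diagonal.measurableSet
    exact (((measurable_bernoulliProduct K).comp (measurable_zeroMarginal K)).prodMk
      measurable_id) hd
  refine ⟨(ν : Measure (ProbabilityMeasure K)).map (bernoulliProduct K), ⟨?_, ?_, ?_⟩, ?_⟩
  · exact Measure.isProbabilityMeasure_map (measurable_bernoulliProduct K).aemeasurable
  · rw [Measure.map_apply (measurable_bernoulliProduct K) hmeas.compl]
    convert measure_empty (μ := (ν : Measure (ProbabilityMeasure K)))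
    refine Set.eq_empty_of_forall_notMem fun π hπ ↦ hπ ?_
    exact ⟨π, rfl⟩
  · exact (isBarycenter_map_bernoulliProduct K).2 hν
  · rintro η ⟨_, hη0, hη⟩
    have hae : bernoulliProduct K ∘ zeroMarginal K =ᵐ[η] id := by
      filter_upwards [mem_ae_iff.2 hη0] with ξ hξ
      exact (mem_bernoulliMeasures K).1 hξ
    -- Being carried by `Ber`, `η` is the image of a measure on the space of probability measures on
    -- `K`, where uniqueness of the mixture applies.
    have hmap : η = (η.map (zeroMarginal K)).map (bernoulliProduct K) := by
      rw [Measure.map_map (measurable_bernoulliProduct K) (measurable_zeroMarginal K),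
        Measure.map_congr hae, Measure.map_id]
    rw [hmap, isBarycenter_map_bernoulliProduct, ← hν] at hη
    have : IsFiniteMeasure (η.map (zeroMarginal K)) := inferInstance
    rw [hmap, eq_of_bernoulliKernel_comp_eq hη]
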